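/- Let $\lambda\in\mathbb C\setminus\{0\}$ not be a positive rational number, let $k\ge 1$ be an integer, and let $R$ be a function near the origin of $\mathbb C^2$ whose germ at $(0,0)$ belongs to $x^k\,\mathbb C\{x,y\}$. Consider the holomorphic foliation $\mathcal F$ defined by the $1$-form $$\omega_R=\lambda x\,dy-y(1+R)\,dx .$$ For $\rho,r>0$ put $\mathcal U(\rho,r)=\rho\mathbb D\times r\mathbb D$, where $\mathbb D$ is the open unit disc of $\mathbb C$. Where $R$ is holomorphic on $\mathcal U(\rho,r)$, let $\tilde{\mathcal F}_{\rho,r}$ be the regular foliation obtained by pulling back $\mathcal F|_{\mathcal U(\rho,r)\setminus\{x=0\}}$ by the universal covering $$\mathcal E(z,y)=(e^z,y),\qquad \mathcal E:\{(z,y): (e^z,y)\in\mathcal U(\rho,r)\}\to\mathcal U(\rho,r)\setminus\{x=0\}.$$ Leaves are endowed with their intrinsic (leaf) topology. Then: 1. There exist $\rho_0>0$ and $r_0>0$ such that $R$ is holomorphic on a neighbourhood of the closure of $\mathcal U(\rho_0,r_0)$ and, for all $0<\rho\le\rho_0$ and $0<r\le r_0$, every leaf of $\tilde{\mathcal F}_{\rho,r}$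 is simply connected. 2. Every pair $\rho_0,r_0>0$ such that $R$ is holomorphic on $\mathcal U(\rho_0,r_0)$ and $$\sup_{(x,y)\in\mathcal U(\rho_0,r_0)}|R(x,y)|<1$$ has this property: for all $0<\rho\le\rho_0$ and $0<r\le r_0$, every leaf of $\tilde{\mathcal F}_{\rho,r}$ is simply connected. -/

import Mathlib

open Set Filter Topology

noncomputable section

/-- The polydisc `ρ𝔻 × r𝔻` in `ℂ²`, with coordinates `(x, y) = (p.1, p.2)`. -/
def polydisc (ρ r : ℝ) : Set (ℂ × ℂ) :=
  Metric.ball (0 : ℂ) ρ ×ˢ Metric.ball (0 : ℂ) r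

/-- A differential `1`-form of type `(1,0)` on `ℂ²` (or on a part of it). -/
abbrev OneForm : Type := ℂ × ℂ → (ℂ × ℂ →L[ℂ] ℂ)

/-- The pull-back `F^* ω` of a `1`-form by a holomorphic map `F`. -/
def OneForm.pullback (F : ℂ × ℂ → ℂ × ℂ) (ω : OneForm) : OneForm :=
  fun p => (ω (F p)).comp (fderiv ℂ F p)

/-- The form `ω_R = λ x dy - y (1 + R) dx`. -/
def omegaForm (lam : ℂ) (R : ℂ × ℂ → ℂ) : OneForm := fun p =>
  (lam * p.1) • ContinuousLinearMap.snd ℂ ℂ ℂ -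
    (p.2 * (1 + R p)) • ContinuousLinearMap.fst ℂ ℂ ℂ

/-- The map `(z, y) ↦ (exp z, y)`. -/
def expCover (p : ℂ × ℂ) : ℂ × ℂ := (Complex.exp p.1, p.2)

/-- The domain `{(z, y) : (exp z, y) ∈ ρ𝔻 × r𝔻 \ {x = 0}}` of the universal covering
`(z, y) ↦ (exp z, y)` of the polydisc minus `{x = 0}`. -/
def coverDomain (ρ r : ℝ) : Set (ℂ × ℂ) :=
  expCover ⁻¹' (polydisc ρ r \ {p | p.1 = 0})

/-- A holomorphic disc `𝔻 → W` tangent to the kernel of `ω`. (Only the values of `toFun` on the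
open unit disc matter.) -/
structure TangentDisc (ω : OneForm) (W : Set (ℂ × ℂ)) where
  toFun : ℂ → ℂ × ℂ
  holomorphic : DifferentiableOn ℂ toFun (Metric.ball 0 1)
  mapsTo : MapsTo toFun (Metric.ball 0 1) W
  tangent : ∀ t ∈ Metric.ball (0 : ℂ) 1, ω (toFun t) (deriv toFun t) = 0

/-- The set `W` foliated by the kernel of `ω`, to be endowed with the leaf topology. It is used
for `W` open in `ℂ²` and `ω` a holomorphic form without zeros on `W`. -/
def FoliatedSpace (_ω : OneForm) (W : Set (ℂ × ℂ)) : Type := W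

/-- A tangent disc as a map from the unit disc to the foliated space. -/
def TangentDisc.toFoliatedSpace {ω : OneForm} {W : Set (ℂ × ℂ)} (φ : TangentDisc ω W) :
    Metric.ball (0 : ℂ) 1 → FoliatedSpace ω W :=
  fun t => ⟨φ.toFun t, φ.mapsTo t.2⟩

/-- The leaf topology: the finest topology for which all holomorphic discs tangent to the kernel
of `ω` are continuous. In a foliated chart `D × T` with plaques `D × {t}`, a tangent disc stays in
one plaque and the plaques are themselves tangent discs, so this is the topology of
`D × T` with `T` discrete, that is, the intrinsic topology of the leaves. -/
instance FoliatedSpace.instTopologicalSpace (ω : OneForm) (W : Set (ℂ × ℂ)) :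
    TopologicalSpace (FoliatedSpace ω W) :=
  ⨆ φ : TangentDisc ω W, TopologicalSpace.coinduced φ.toFoliatedSpace inferInstance

/-- The leaves are the connected components for the leaf topology; the topology of a leaf is the
one induced by the leaf topology. -/
def IsLeaf {ω : OneForm} {W : Set (ℂ × ℂ)} (L : Set (FoliatedSpace ω W)) : Prop :=
  ∃ p : FoliatedSpace ω W, L = connectedComponent p

/-- Every leaf of the pull-back by `(z, y) ↦ (exp z, y)` of the foliation `ω_R = 0` of
`ρ𝔻 × r𝔻 \ {x = 0}` is simply connected. -/
def LiftedLeavesSimplyConnected (lam : ℂ) (R : ℂ × ℂ → ℂ) (ρ r : ℝ) : Prop :=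
  ∀ L : Set (FoliatedSpace ((omegaForm lam R).pullback expCover) (coverDomain ρ r)),
    IsLeaf L → SimplyConnectedSpace L

/-- The eigenvalue ratio of a non-degenerate reduced singularity: it is neither zero nor a positive
rational number. -/
def IsNondegenerateReducedRatio (lam : ℂ) : Prop :=
  lam ≠ 0 ∧ ∀ q : ℚ, 0 < q → lam ≠ (q : ℂ)

/-- The germ of `R` at the origin belongs to `x^k ℂ{x, y}`. -/
def GermMemXPow (k : ℕ) (R : ℂ × ℂ → ℂ) : Prop :=
  ∃ A : ℂ × ℂ → ℂ, AnalyticAt ℂ A 0 ∧ ∀ᶠ p in 𝓝 (0 : ℂ × ℂ), R p = p.1 ^ k * A p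

/-- The pulled-back form is `exp z (λ dy - y (1 + R (exp z, y)) dz)`. -/
theorem pullback_omegaForm_apply (lam : ℂ) (R : ℂ × ℂ → ℂ) (p v : ℂ × ℂ) :
    (omegaForm lam R).pullback expCover p v =
      Complex.exp p.1 * (lam * v.2 - p.2 * (1 + R (Complex.exp p.1, p.2)) * v.1) := by
  have h : HasFDerivAt expCover
      ((Complex.exp p.1 • ContinuousLinearMap.fst ℂ ℂ ℂ).prod (ContinuousLinearMap.snd ℂ ℂ ℂ))
      p := (hasFDerivAt_fst.cexp).prodMk hasFDerivAt_snd
  simp only [OneForm.pullback, h.fderiv, omegaForm, expCover, ContinuousLinearMap.comp_apply,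
    ContinuousLinearMap.prod_apply, sub_apply, smul_apply,
    ContinuousLinearMap.coe_fst', ContinuousLinearMap.coe_snd', smul_eq_mul]
  ring

/-- The pulled-back form has no zeros, so it defines a regular foliation. -/
theorem pullback_omegaForm_ne_zero {lam : ℂ} (hlam : lam ≠ 0) (R : ℂ × ℂ → ℂ) (p : ℂ × ℂ) :
    (omegaForm lam R).pullback expCover p ≠ 0 := by
  intro h
  have h1 := pullback_omegaForm_apply lam R p (0, 1)
  rw [h] at h1
  simp [hlam, Complex.exp_ne_zero] at h1

end

/-! In the coordinates `(z, y)` the foliation is the equation `y' = F (z, y)` with `F = y (1 + R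
(exp z, y)) / lam`, on the product of the half-plane `H = {Re z < log ρ}` and the disc of radius
`r`. Along a ray `z + t v` with `v = -lam`, the derivative of `|y|²` is `-2 |y|² Re (1 + R)`, which
is nonpositive when `|R| < 1`. A solution therefore cannot escape through `|y| = r`, and it
continues along the ray as long as the ray stays in `H` (`exists_isSolutionOn_segment`). Hence a
solution on a small disc extends to the part of `H` swept by pushing the disc along `v`
(`exists_isForwardSolution`). Two such domains meet in a connected set, so solutions that agree at
one point glue (`IsForwardSolution.exists_glue`). Consequently a leaf is the graph of a single
function over its projection to the `z`-plane. That projection is open, meets each line directed by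
`v` in an interval, and has an interval as its image in the quotient by `v`. It retracts along these
lines onto a section, hence is contractible (`contractibleSpace_of_convex_fibers`), and so is the
leaf. Near the origin `|R| < 1` is automatic, because `R 0 = 0`. -/

/-! ### Uniqueness for holomorphic differential equations. -/

/-- `g` solves the differential equation `g' = F (w, g)` on `U`, with graph in `W`. -/
def IsSolutionOn (F : ℂ × ℂ → ℂ) (W : Set (ℂ × ℂ)) (g : ℂ → ℂ) (U : Set ℂ) : Prop :=
  ∀ w ∈ U, (w, g w) ∈ W ∧ HasDerivAt g (F (w, g w)) w

namespace IsSolutionOn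

variable {F : ℂ × ℂ → ℂ} {W : Set (ℂ × ℂ)} {g : ℂ → ℂ} {U V : Set ℂ}

theorem mono (hg : IsSolutionOn F W g U) (hVU : V ⊆ U) : IsSolutionOn F W g V :=
  fun w hw => hg w (hVU hw)

theorem differentiableOn (hg : IsSolutionOn F W g U) : DifferentiableOn ℂ g U :=
  fun w hw => (hg w hw).2.differentiableAt.differentiableWithinAt

theorem of_eventuallyEq (hg : ∀ w ∈ U, ∃ k V, IsSolutionOn F W k V ∧ w ∈ V ∧ g =ᶠ[𝓝 w] k) :
    IsSolutionOn F W g U := by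
  intro w hw
  obtain ⟨k, V, hk, hwV, he⟩ := hg w hw
  have h1 := hk w hwV
  rw [← he.eq_of_nhds] at h1
  exact ⟨h1.1, h1.2.congr_of_eventuallyEq he⟩

end IsSolutionOn

/-- A holomorphic function whose derivative is dominated by its values vanishes near each of its
zeros. -/
theorem eventually_eq_zero_of_norm_deriv_le {e : ℂ → ℂ} {t₀ : ℂ} {K : ℝ} (h0 : e t₀ = 0)
    (he : ∀ᶠ t in 𝓝 t₀, ∃ e', HasDerivAt e e' t ∧ ‖e'‖ ≤ K * ‖e t‖) :
    ∀ᶠ t in 𝓝 t₀, e t = 0 := by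
  obtain ⟨ε, hε, hball⟩ := Metric.eventually_nhds_iff_ball.1 he
  choose! e' he' hb using hball
  filter_upwards [Metric.ball_mem_nhds t₀ hε] with t ht
  have hseg : ∀ s ∈ Icc (0 : ℝ) 1, t₀ + s * (t - t₀) ∈ Metric.ball t₀ ε := by
    intro s hs
    rw [mem_ball_iff_norm] at ht ⊢
    rw [add_sub_cancel_left, norm_mul, Complex.norm_real, Real.norm_of_nonneg hs.1]
    exact (mul_le_of_le_one_left (norm_nonneg _) hs.2).trans_lt ht
  have hd : ∀ s ∈ Icc (0 : ℝ) 1, HasDerivAt (fun s : ℝ => e (t₀ + s * (t - t₀)))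
      (e' (t₀ + s * (t - t₀)) * (t - t₀)) s := by
    intro s hs
    have h1 : HasDerivAt (fun s : ℂ => t₀ + s * (t - t₀)) (t - t₀) (s : ℂ) := by
      simpa using ((hasDerivAt_id (s : ℂ)).mul_const (t - t₀)).const_add t₀
    exact (HasDerivAt.comp (s : ℂ) (he' _ (hseg s hs)) h1).comp_ofReal
  -- Grönwall's inequality on the real segment from `t₀` to `t`.
  have h := eq_zero_of_abs_deriv_le_mul_abs_self_of_eq_zero_right
    (f := fun s : ℝ => e (t₀ + s * (t - t₀))) (K := K * ‖t - t₀‖) (a := 0) (b := 1)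
    (fun s hs => (hd s hs).continuousAt.continuousWithinAt)
    (fun s hs => (hd s (Ico_subset_Icc_self hs)).hasDerivWithinAt) (by simp [h0])
    (fun s hs => by
      rw [norm_mul, mul_right_comm]
      exact mul_le_mul_of_nonneg_right (hb _ (hseg s (Ico_subset_Icc_self hs))) (norm_nonneg _))
    1 (right_mem_Icc.2 zero_le_one)
  simpa using h

/-- A holomorphic curve tangent to `dy = F dz` which meets the graph of a solution stays in it
locally. -/
theorem IsSolutionOn.eventually_curve_eq {F : ℂ × ℂ → ℂ} {W : Set (ℂ × ℂ)} {g : ℂ → ℂ} {U : Set ℂ}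
    (hF : AnalyticOnNhd ℂ F W) (hU : IsOpen U) (hg : IsSolutionOn F W g U) {a b : ℂ → ℂ} {t₀ : ℂ}
    (ha : ∀ᶠ t in 𝓝 t₀, DifferentiableAt ℂ a t)
    (hb : ∀ᶠ t in 𝓝 t₀, HasDerivAt b (F (a t, b t) * deriv a t) t)
    (hmem : a t₀ ∈ U) (h0 : b t₀ = g (a t₀)) : ∀ᶠ t in 𝓝 t₀, b t = g (a t) := by
  have hac : ContinuousAt a t₀ := ha.self_of_nhds.continuousAt
  have hbc : ContinuousAt b t₀ := hb.self_of_nhds.continuousAt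
  have hgc : ContinuousAt g (a t₀) := (hg _ hmem).2.continuousAt
  obtain ⟨K, s, hs, hK⟩ := ((hF _ (hg _ hmem).1).contDiffAt (n := 1)).exists_lipschitzOnWith
  have hs1 : ∀ᶠ t in 𝓝 t₀, (a t, g (a t)) ∈ s :=
    (hac.prodMk (hgc.comp hac)).eventually_mem hs
  have hs2 : ∀ᶠ t in 𝓝 t₀, (a t, b t) ∈ s :=
    (hac.prodMk hbc).eventually_mem (by rw [h0]; exact hs)
  have han : AnalyticAt ℂ a t₀ := Complex.analyticAt_iff_eventually_differentiableAt.2 ha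
  have hda : ∀ᶠ t in 𝓝 t₀, ‖deriv a t‖ < ‖deriv a t₀‖ + 1 :=
    han.deriv.continuousAt.norm.eventually_lt_const (lt_add_one _)
  -- The difference has derivative `(F (a, b) - F (a, g a)) a'`, which a local Lipschitz constant of
  -- `F` and a bound for `a'` control by the difference itself.
  have key : ∀ᶠ t in 𝓝 t₀, b t - g (a t) = 0 := by
    refine eventually_eq_zero_of_norm_deriv_le (K := K * (‖deriv a t₀‖ + 1)) (by simp [h0]) ?_
    filter_upwards [hs1, hs2, hda, ha, hb, hac.eventually_mem (hU.mem_nhds hmem)]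
      with t h1 h2 h3 h4 h5 h6
    refine ⟨_, h5.sub ((hg _ h6).2.comp t h4.hasDerivAt), ?_⟩
    rw [← sub_mul, norm_mul]
    have h7 := hK.norm_sub_le h2 h1
    simp only [Prod.mk_sub_mk, sub_self, Prod.norm_mk, norm_zero] at h7
    rw [max_eq_right (norm_nonneg _)] at h7
    calc _ ≤ (K * ‖b t - g (a t)‖) * (‖deriv a t₀‖ + 1) :=
          mul_le_mul h7 h3.le (norm_nonneg _) (by positivity)
      _ = _ := by ring
  filter_upwards [key] with t ht using sub_eq_zero.1 ht

/-- Local uniqueness is the preceding result for the curve `t ↦ (t, g t)`; the identity theorem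
propagates it. -/
theorem IsSolutionOn.eqOn_of_isPreconnected {F : ℂ × ℂ → ℂ} {W : Set (ℂ × ℂ)} {g h : ℂ → ℂ}
    {U : Set ℂ} (hF : AnalyticOnNhd ℂ F W) (hU : IsOpen U) (hc : IsPreconnected U)
    (hg : IsSolutionOn F W g U) (hh : IsSolutionOn F W h U) {w : ℂ} (hw : w ∈ U)
    (heq : g w = h w) : EqOn g h U := by
  refine AnalyticOnNhd.eqOn_of_preconnected_of_eventuallyEq
    (hg.differentiableOn.analyticOnNhd hU) (hh.differentiableOn.analyticOnNhd hU) hc hw ?_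
  refine hh.eventually_curve_eq hF hU (a := id) (b := g) ?_ ?_ hw heq
  · exact Eventually.of_forall fun t => differentiableAt_id
  · filter_upwards [hU.mem_nhds hw] with t ht
    simpa using (hg t ht).2

/-! ### Local existence with uniform radius. -/

/-- Holomorphic Picard theorem, with a radius which depends only on bounds for `F`. -/
theorem exists_isSolutionOn_of_lipschitz {F : ℂ × ℂ → ℂ} {W : Set (ℂ × ℂ)} {p : ℂ × ℂ}
    {δ M L : ℝ} (hF : DifferentiableOn ℂ F W) (hW : IsOpen W) (hδ : 0 < δ) (hM : 0 ≤ M)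
    (hsub : Metric.ball p.1 δ ×ˢ Metric.closedBall p.2 (M * δ) ⊆ W)
    (hFM : ∀ q ∈ Metric.ball p.1 δ ×ˢ Metric.closedBall p.2 (M * δ), ‖F q‖ ≤ M)
    (hFL : ∀ z ∈ Metric.ball p.1 δ, ∀ y ∈ Metric.closedBall p.2 (M * δ),
      ∀ y' ∈ Metric.closedBall p.2 (M * δ), ‖F (z, y) - F (z, y')‖ ≤ L * ‖y - y'‖)
    (hL : L * δ ≤ 1 / 2) (hL0 : 0 ≤ L) :
    ∃ g, IsSolutionOn F W g (Metric.ball p.1 δ) ∧ g p.1 = p.2 := by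
  set B := Metric.ball p.1 δ
  set C := Metric.closedBall p.2 (M * δ) with hC
  have hpB : p.1 ∈ B := Metric.mem_ball_self hδ
  have hconv : Convex ℝ B := convex_ball _ _
  -- Picard iteration acts on `S`: on a disc, `F (z, g z)` has a primitive, and the bound `M` keeps
  -- that primitive inside `C`.
  let S : Type := {g : ℂ → ℂ // DifferentiableOn ℂ g B ∧ MapsTo g B C ∧ g p.1 = p.2}
  have hstep : ∀ g : S, ∃ P : S, ∀ z ∈ B, HasDerivAt P.1 (F (z, g.1 z)) z := by
    rintro ⟨g, hgd, hgm, hg0⟩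
    have hd : DifferentiableOn ℂ (fun z => F (z, g z)) B :=
      hF.comp (differentiableOn_id.prodMk hgd) fun z hz => hsub ⟨hz, hgm hz⟩
    obtain ⟨P, hP0, hP⟩ := hd.isExactOn_ball.with_val_at p.1 p.2
    refine ⟨⟨P, fun z hz => (hP z hz).differentiableAt.differentiableWithinAt, ?_, hP0⟩, hP⟩
    intro z hz
    have h1 := hconv.norm_image_sub_le_of_norm_hasDerivWithin_le
      (fun z hz => (hP z hz).hasDerivWithinAt) (fun z hz => hFM _ ⟨hz, hgm hz⟩) hpB hz
    rw [hP0] at h1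
    rw [hC, mem_closedBall_iff_norm]
    exact h1.trans (mul_le_mul_of_nonneg_left (mem_ball_iff_norm.1 hz).le hM)
  choose T hT using hstep
  let g₀ : S := ⟨fun _ => p.2, differentiableOn_const _,
    fun z _ => Metric.mem_closedBall_self (by positivity), rfl⟩
  let G : ℕ → S := fun n => T^[n] g₀
  have hGs : ∀ n, G (n + 1) = T (G n) := fun n => Function.iterate_succ_apply' T n g₀
  -- Each iteration halves the distance since `L * δ ≤ 1 / 2`; the bound is written in the shape
  -- that `cauchySeq_of_le_geometric_two` expects.
  have hdist : ∀ n, ∀ z ∈ B, dist ((G n).1 z) ((G (n + 1)).1 z) ≤ (2 * (M * δ)) / 2 / 2 ^ n := by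
    intro n
    induction n with
    | zero =>
      intro z hz
      have h : dist p.2 ((G 1).1 z) ≤ M * δ := by
        rw [dist_comm]
        exact Metric.mem_closedBall.1 ((G 1).2.2.1 hz)
      simpa [G, g₀] using h
    | succ n ih =>
      intro z hz
      have hd : ∀ w ∈ B, HasDerivWithinAt (fun w => (G (n + 1)).1 w - (G (n + 2)).1 w)
          (F (w, (G n).1 w) - F (w, (G (n + 1)).1 w)) B w := by
        intro w hw
        have h1 := hT (G n) w hw
        have h2 := hT (G (n + 1)) w hw
        rw [← hGs] at h1 h2
        exact (h1.sub h2).hasDerivWithinAt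
      have hb : ∀ w ∈ B, ‖F (w, (G n).1 w) - F (w, (G (n + 1)).1 w)‖
          ≤ L * ((2 * (M * δ)) / 2 / 2 ^ n) := by
        intro w hw
        refine (hFL w hw _ ((G n).2.2.1 hw) _ ((G (n + 1)).2.2.1 hw)).trans ?_
        rw [← dist_eq_norm]
        exact mul_le_mul_of_nonneg_left (ih w hw) hL0
      have h1 := hconv.norm_image_sub_le_of_norm_hasDerivWithin_le hd hb hpB hz
      rw [(G (n + 1)).2.2.2, (G (n + 2)).2.2.2, sub_self, sub_zero, ← dist_eq_norm] at h1
      have h2 : ‖z - p.1‖ ≤ δ := (mem_ball_iff_norm.1 hz).le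
      have h3 : 0 ≤ (2 * (M * δ)) / 2 / 2 ^ n := by positivity
      calc _ ≤ L * ((2 * (M * δ)) / 2 / 2 ^ n) * ‖z - p.1‖ := h1
        _ ≤ L * ((2 * (M * δ)) / 2 / 2 ^ n) * δ := by gcongr
        _ = (L * δ) * ((2 * (M * δ)) / 2 / 2 ^ n) := by ring
        _ ≤ 1 / 2 * ((2 * (M * δ)) / 2 / 2 ^ n) := by gcongr
        _ = _ := by rw [pow_succ]; field_simp
  have hlim : ∀ z, ∃ l, z ∈ B → Tendsto (fun n => (G n).1 z) atTop (𝓝 l) := by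
    intro z
    by_cases hz : z ∈ B
    · obtain ⟨l, hl⟩ := cauchySeq_tendsto_of_complete
        (cauchySeq_of_le_geometric_two fun n => hdist n z hz)
      exact ⟨l, fun _ => hl⟩
    · exact ⟨0, fun h => absurd h hz⟩
  choose g hg using hlim
  have hunif : TendstoUniformlyOn (fun n => (G n).1) g atTop B := by
    rw [Metric.tendstoUniformlyOn_iff]
    intro ε hε
    have h0 : Tendsto (fun n : ℕ => 2 * (M * δ) / 2 ^ n) atTop (𝓝 0) :=
      tendsto_const_nhds.div_atTop (tendsto_pow_atTop_atTop_of_one_lt one_lt_two)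
    filter_upwards [h0.eventually_lt_const hε] with n hn z hz
    rw [dist_comm]
    exact (dist_le_of_le_geometric_two_of_tendsto (fun n => hdist n z hz) (hg z hz) n).trans_lt hn
  have hloc := hunif.tendstoLocallyUniformlyOn
  have hdiff : ∀ᶠ n in atTop, DifferentiableOn ℂ ((fun n => (G n).1) n) B :=
    Eventually.of_forall fun n => (G n).2.1
  have hgd : DifferentiableOn ℂ g B := hloc.differentiableOn hdiff Metric.isOpen_ball
  have hgC : MapsTo g B C := fun z hz => Metric.isClosed_closedBall.mem_of_tendsto (hg z hz)
    (Eventually.of_forall fun n => (G n).2.2.1 hz)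
  refine ⟨g, fun z hz => ⟨hsub ⟨hz, hgC hz⟩, ?_⟩, ?_⟩
  · have h1 := ((hloc.deriv hdiff Metric.isOpen_ball).tendsto_at hz).comp (tendsto_add_atTop_nat 1)
    have h2 : Tendsto (fun n => F (z, (G n).1 z)) atTop (𝓝 (F (z, g z))) :=
      ((hF.differentiableAt (hW.mem_nhds (hsub ⟨hz, hgC hz⟩))).continuousAt.tendsto).comp
        (tendsto_const_nhds.prodMk_nhds (hg z hz))
    have h3 : deriv g z = F (z, g z) := by
      refine tendsto_nhds_unique h1 (h2.congr fun n => ?_)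
      simp only [Function.comp_apply, hGs]
      exact (hT (G n) z hz).deriv.symm
    rw [← h3]
    exact (hgd.differentiableAt (Metric.isOpen_ball.mem_nhds hz)).hasDerivAt
  · exact tendsto_nhds_unique (hg _ hpB)
      (tendsto_const_nhds.congr fun n => (G n).2.2.2.symm)

/-- Local solutions exist on discs whose radius is uniform for initial conditions in a compact
set. -/
theorem exists_isSolutionOn_of_isCompact {F : ℂ × ℂ → ℂ} {W K : Set (ℂ × ℂ)}
    (hF : AnalyticOnNhd ℂ F W) (hW : IsOpen W) (hK : IsCompact K) (hKW : K ⊆ W) :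
    ∃ δ > 0, ∀ p ∈ K, ∃ g, IsSolutionOn F W g (Metric.ball p.1 δ) ∧ g p.1 = p.2 := by
  obtain ⟨ε, hε, hεW⟩ := hK.exists_cthickening_subset_open hW hKW
  have hK' : IsCompact (Metric.cthickening ε K) := hK.cthickening
  obtain ⟨M, hM⟩ := hK'.exists_bound_of_continuousOn (hF.continuousOn.mono hεW)
  have hlip : LocallyLipschitzOn (Metric.cthickening ε K) F := by
    intro x hx
    obtain ⟨L, s, hs, hL⟩ := ((hF x (hεW hx)).contDiffAt (n := 1)).exists_lipschitzOnWith
    exact ⟨L, s, mem_nhdsWithin_of_mem_nhds hs, hL⟩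
  obtain ⟨L, hL⟩ := hlip.exists_lipschitzOnWith_of_compact hK'
  set M' := max M 0
  have hM0 : 0 ≤ M' := le_max_right _ _
  have hL0 : (0 : ℝ) ≤ L := L.2
  -- The three terms ensure, in order, that the disc stays in the thickening, that `M' * δ ≤ ε`, and
  -- that `L * δ ≤ 1 / 2`; adding `1` avoids zero denominators.
  set δ := min ε (min (ε / (M' + 1)) (1 / (2 * (L + 1))))
  have hδ0 : 0 < δ := by positivity
  have h1 : M' * δ ≤ ε := by
    calc M' * δ ≤ (M' + 1) * (ε / (M' + 1)) := by
          gcongr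
          · exact le_add_of_nonneg_right zero_le_one
          · exact (min_le_right _ _).trans (min_le_left _ _)
      _ = ε := by field_simp
  have h2 : L * δ ≤ 1 / 2 := by
    calc L * δ ≤ (L + 1) * (1 / (2 * (L + 1))) := by
          gcongr
          · exact le_add_of_nonneg_right zero_le_one
          · exact (min_le_right _ _).trans (min_le_right _ _)
      _ = 1 / 2 := by field_simp
  refine ⟨δ, hδ0, fun p hp => ?_⟩
  have hsub : Metric.ball p.1 δ ×ˢ Metric.closedBall p.2 (M' * δ) ⊆ Metric.cthickening ε K := by
    refine Subset.trans ?_ (Metric.closedBall_subset_cthickening hp ε)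
    rintro ⟨z, y⟩ ⟨hz, hy⟩
    rw [Metric.mem_closedBall, Prod.dist_eq]
    exact max_le ((Metric.mem_ball.1 hz).le.trans (min_le_left _ _))
      ((Metric.mem_closedBall.1 hy).trans h1)
  refine exists_isSolutionOn_of_lipschitz (M := M') (L := L) hF.differentiableOn hW hδ0 hM0
    (hsub.trans hεW) (fun q hq => (hM q (hsub hq)).trans (le_max_left _ _)) ?_ h2 hL0
  intro z hz y hy y' hy'
  have h := hL.norm_sub_le (hsub (mk_mem_prod hz hy)) (hsub (mk_mem_prod hz hy'))
  rwa [Prod.mk_sub_mk, sub_self, Prod.norm_mk, norm_zero, max_eq_right (norm_nonneg _)] at h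
-- Contractibility of plane sets with convex fibres.
theorem Convex.add_mul_mem {N : Set ℂ} (hN : Convex ℝ N) {z v : ℂ} {T s : ℝ} (hz : z ∈ N)
    (hT : z + T * v ∈ N) (hs : s ∈ Icc 0 T) : z + s * v ∈ N := by
  rcases (hs.1.trans hs.2).eq_or_lt with h0 | h0
  · obtain rfl : s = 0 := le_antisymm (h0 ▸ hs.2) hs.1
    simpa using hz
  · have h := hN.add_smul_mem hz hT (t := s / T)
      ⟨div_nonneg hs.1 h0.le, div_le_one_of_le₀ hs.2 h0.le⟩
    have h1 : (T : ℂ) ≠ 0 := by exact_mod_cast h0.ne'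
    convert h using 2
    rw [Complex.real_smul]
    push_cast
    field_simp

/-- A nonempty open subset of the plane whose traces on the lines directed by `v` are intervals, and
whose projection along `v` is an interval, is contractible. -/
theorem contractibleSpace_of_convex_fibers {Ω : Set ℂ} {v : ℂ} (hv : v ≠ 0) (hΩ : IsOpen Ω)
    (hne : Ω.Nonempty) (hI : ((fun z : ℂ => (z / v).im) '' Ω).OrdConnected)
    (hfib : ∀ z ∈ Ω, ∀ T : ℝ, z + T * v ∈ Ω → ∀ s ∈ Icc 0 T, z + s * v ∈ Ω) :
    ContractibleSpace Ω := by
  set I : Set ℝ := (fun z : ℂ => (z / v).im) '' Ω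
  have hIc : ContractibleSpace I := hI.convex.contractibleSpace (hne.image _)
  let line : ℝ → ℝ → ℂ := fun s τ => (τ + s * Complex.I) * v
  have hline : ∀ z : ℂ, line (z / v).im (z / v).re = z := fun z => by
    simp only [line, Complex.re_add_im, div_mul_cancel₀ _ hv]
  have hline_im : ∀ s τ, (line s τ / v).im = s := fun s τ => by
    simp [line, hv]
  have hconv : ∀ s : I, Convex ℝ {τ : ℝ | line s τ ∈ Ω} := by
    intro s
    refine OrdConnected.convex ⟨fun a ha b hb c hc => ?_⟩
    change line s a ∈ Ω at ha
    change line s b ∈ Ω at hb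
    change line s c ∈ Ω
    have h := hfib _ ha (b - a) (by convert hb using 1; simp only [line]; push_cast; ring) (c - a)
      ⟨by linarith [hc.1], by linarith [hc.2]⟩
    convert h using 1
    simp only [line]; push_cast; ring
  -- A continuous choice of one point on each line: openness of `Ω` makes a fixed parameter
  -- admissible on nearby lines, and convexity of the fibres allows these local choices to be
  -- averaged.
  obtain ⟨σ, hσ⟩ := exists_continuous_forall_mem_convex_of_local_const hconv (by
    rintro ⟨_, z, hz, rfl⟩
    refine ⟨(z / v).re, ?_⟩
    have hc : Continuous fun s : I => line s (z / v).re := by fun_prop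
    exact hc.continuousAt.eventually_mem (hΩ.mem_nhds (by simpa only [hline] using hz)))
  let c : C(Ω, I) := ⟨fun z => ⟨(z.1 / v).im, mem_image_of_mem _ z.2⟩, by fun_prop⟩
  let d : C(I, Ω) := ⟨fun s => ⟨line s (σ s), hσ s⟩, by fun_prop⟩
  have hmem : ∀ (u : unitInterval) (z : Ω),
      line (z.1 / v).im ((1 - u) * σ (c z) + u * (z.1 / v).re) ∈ Ω := by
    intro u z
    have h := hconv (c z) (hσ (c z)) (y := (z.1 / v).re)
      (by simpa only [c, ContinuousMap.coe_mk, mem_ofPred_eq, hline] using z.2)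
      (sub_nonneg.2 u.2.2) u.2.1 (by ring)
    exact h
  -- `Ω` slides along the lines onto the section `σ`, which is a copy of the interval `I`.
  let e : ContinuousMap.HomotopyEquiv Ω I :=
    { toFun := c
      invFun := d
      left_inv := ⟨{
        toFun := fun p => ⟨_, hmem p.1 p.2⟩
        continuous_toFun := by fun_prop
        map_zero_left := fun z => by ext; simp [d, c]
        map_one_left := fun z => by ext; simp [hline] }⟩
      right_inv := by
        rw [show c.comp d = ContinuousMap.id I from by ext s; simp [c, d, hline_im]] }
  exact e.contractibleSpace

/-! ### Gluing, and continuation along dissipative rays. -/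

/-- Two solutions which agree on the overlap of their domains can be glued. -/
theorem IsSolutionOn.exists_glue {F : ℂ × ℂ → ℂ} {W : Set (ℂ × ℂ)} {g h : ℂ → ℂ} {U V : Set ℂ}
    (hU : IsOpen U) (hV : IsOpen V) (hg : IsSolutionOn F W g U) (hh : IsSolutionOn F W h V)
    (heq : EqOn g h (U ∩ V)) :
    ∃ f, IsSolutionOn F W f (U ∪ V) ∧ EqOn f g U ∧ EqOn f h V := by
  classical
  have h1 : EqOn (U.piecewise g h) g U := piecewise_eqOn _ _ _
  have h2 : EqOn (U.piecewise g h) h V := by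
    intro w hw
    by_cases hwU : w ∈ U
    · rw [h1 hwU, heq ⟨hwU, hw⟩]
    · exact piecewise_eq_of_notMem _ _ _ hwU
  refine ⟨U.piecewise g h, IsSolutionOn.of_eventuallyEq ?_, h1, h2⟩
  rintro w (hw | hw)
  · exact ⟨g, U, hg, hw, h1.eventuallyEq_of_mem (hU.mem_nhds hw)⟩
  · exact ⟨h, V, hh, hw, h2.eventuallyEq_of_mem (hV.mem_nhds hw)⟩

/-- The equation `y' = F (z, y)` on `H × r𝔻`, with `H` convex, is dissipative in the direction `v`:
the modulus of its solutions does not increase along the rays directed by `v`. -/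
structure IsDissipative (F : ℂ × ℂ → ℂ) (H : Set ℂ) (r : ℝ) (v : ℂ) : Prop where
  isOpen : IsOpen H
  convex : Convex ℝ H
  ne_zero : v ≠ 0
  analyticOnNhd : AnalyticOnNhd ℂ F (H ×ˢ Metric.ball 0 r)
  re_le : ∀ p ∈ H ×ˢ Metric.ball (0 : ℂ) r, (v * F p * (starRingEnd ℂ) p.2).re ≤ 0

namespace IsDissipative

variable {F : ℂ × ℂ → ℂ} {H : Set ℂ} {r : ℝ} {v : ℂ}

theorem isOpen_prod (hF : IsDissipative F H r v) : IsOpen (H ×ˢ Metric.ball (0 : ℂ) r) :=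
  hF.isOpen.prod Metric.isOpen_ball

/-- The derivative of `|g|²` along the ray is twice the quantity whose sign is prescribed by
`re_le`. -/
theorem norm_le (hF : IsDissipative F H r v) {g : ℂ → ℂ} {U : Set ℂ}
    (hg : IsSolutionOn F (H ×ˢ Metric.ball 0 r) g U) {w : ℂ} {T : ℝ} (hT : 0 ≤ T)
    (hU : ∀ t ∈ Icc 0 T, w + (t : ℝ) * v ∈ U) : ‖g (w + T * v)‖ ≤ ‖g w‖ := by
  have hd : ∀ t ∈ Icc 0 T, HasDerivAt (fun t : ℝ => g (w + t * v))
      (F (w + t * v, g (w + t * v)) * v) t := by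
    intro t ht
    have h1 : HasDerivAt (fun s : ℂ => w + s * v) v (t : ℂ) := by
      simpa using ((hasDerivAt_id (t : ℂ)).mul_const v).const_add w
    exact (HasDerivAt.comp (t : ℂ) (hg _ (hU t ht)).2 h1).comp_ofReal
  have hanti : AntitoneOn (fun t : ℝ => ‖g (w + t * v)‖ ^ 2) (Icc 0 T) := by
    refine antitoneOn_of_deriv_nonpos (convex_Icc 0 T)
      (fun t ht => (hd t ht).norm_sq.continuousAt.continuousWithinAt)
      (fun t ht => (hd t (interior_subset ht)).norm_sq.differentiableAt.differentiableWithinAt)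
      fun t ht => ?_
    rw [(hd t (interior_subset ht)).norm_sq.deriv, Complex.inner]
    have h := hF.re_le _ (hg _ (hU t (interior_subset ht))).1
    rw [mul_comm v] at h
    linarith
  have h := hanti (left_mem_Icc.2 hT) (right_mem_Icc.2 hT) hT
  simp only [Complex.ofReal_zero, zero_mul, add_zero] at h
  exact (sq_le_sq₀ (norm_nonneg _) (norm_nonneg _)).1 h

/-- Since the modulus does not increase, the continued graph over the segment stays in a fixed
compact set. The radius of local existence is uniform there, so finitely many steps reach the end.
-/
theorem exists_isSolutionOn_segment (hF : IsDissipative F H r v) {w y : ℂ} (hw : w ∈ H)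
    (hy : y ∈ Metric.ball (0 : ℂ) r) {T : ℝ} (hT : 0 ≤ T) (hwT : w + T * v ∈ H) :
    ∃ N g, IsOpen N ∧ Convex ℝ N ∧ (∀ t ∈ Icc 0 T, w + (t : ℝ) * v ∈ N) ∧
      IsSolutionOn F (H ×ˢ Metric.ball 0 r) g N ∧ g w = y := by
  have hcont : Continuous fun t : ℝ => w + t * v := by fun_prop
  have hK : IsCompact (((fun t : ℝ => w + t * v) '' Icc 0 T) ×ˢ Metric.closedBall (0 : ℂ) ‖y‖) :=
    (isCompact_Icc.image hcont).prod (isCompact_closedBall _ _)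
  have hKW : ((fun t : ℝ => w + t * v) '' Icc 0 T) ×ˢ Metric.closedBall (0 : ℂ) ‖y‖ ⊆
      H ×ˢ Metric.ball 0 r := by
    refine prod_mono ?_ (Metric.closedBall_subset_ball (mem_ball_zero_iff.1 hy))
    rintro _ ⟨t, ht, rfl⟩
    exact hF.convex.add_mul_mem hw hwT ht
  obtain ⟨δ, hδ, hex⟩ := exists_isSolutionOn_of_isCompact hF.analyticOnNhd hF.isOpen_prod hK hKW
  have hv : 0 < ‖v‖ := norm_pos_iff.2 hF.ne_zero
  have hη : 0 < δ / (2 * ‖v‖) := by positivity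
  -- Each step advances by half the existence radius, measured along `v`. The domain is kept convex
  -- so that its overlap with the next disc is connected.
  have key : ∀ n : ℕ, ∃ N g, IsOpen N ∧ Convex ℝ N ∧
      (∀ t ∈ Icc 0 (min (n * (δ / (2 * ‖v‖))) T), w + (t : ℝ) * v ∈ N) ∧
      IsSolutionOn F (H ×ˢ Metric.ball 0 r) g N ∧ g w = y := by
    intro n
    induction n with
    | zero =>
      obtain ⟨g, hg, hgw⟩ := hex (w, y) ⟨⟨0, left_mem_Icc.2 hT, by simp⟩, by simp⟩
      refine ⟨_, g, Metric.isOpen_ball, convex_ball w δ, ?_, hg, hgw⟩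
      intro t ht
      simp only [Nat.cast_zero, zero_mul, min_eq_left hT, Icc_self, mem_singleton_iff] at ht
      simp [ht, hδ]
    | succ n ih =>
      obtain ⟨N, g, hNo, hNc, hN, hg, hgw⟩ := ih
      set τ := min (n * (δ / (2 * ‖v‖))) T with hτ
      set τ' := min ((n + 1 : ℕ) * (δ / (2 * ‖v‖))) T
      have hτ0 : 0 ≤ τ := le_min (by positivity) hT
      have hτ'0 : 0 ≤ τ' := le_min (by positivity) hT
      have hstep : τ' ≤ τ + δ / (2 * ‖v‖) := by
        rw [hτ, ← min_add_add_right]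
        refine min_le_min (by push_cast; linarith) (by linarith)
      have hwτ : w ∈ N := by simpa using hN 0 (left_mem_Icc.2 hτ0)
      obtain ⟨k, hk, hkw⟩ := hex (w + τ * v, g (w + τ * v))
        ⟨⟨τ, ⟨hτ0, min_le_right _ _⟩, rfl⟩, by
          rw [mem_closedBall_zero_iff, ← hgw]
          exact hF.norm_le hg hτ0 hN⟩
      have hinter : EqOn g k (N ∩ Metric.ball (w + τ * v) δ) :=
        IsSolutionOn.eqOn_of_isPreconnected hF.analyticOnNhd (hNo.inter Metric.isOpen_ball)
          (hNc.inter (convex_ball _ _)).isPreconnected (hg.mono inter_subset_left)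
          (hk.mono inter_subset_right) ⟨hN τ (right_mem_Icc.2 hτ0), Metric.mem_ball_self hδ⟩
          hkw.symm
      obtain ⟨f, hf, hfg, -⟩ := hg.exists_glue hNo Metric.isOpen_ball hk hinter
      have hsub : (fun t : ℝ => w + t * v) '' Icc 0 τ' ⊆ N ∪ Metric.ball (w + τ * v) δ := by
        rintro _ ⟨t, ht, rfl⟩
        rcases le_or_gt t τ with h | h
        · exact Or.inl (hN t ⟨ht.1, h⟩)
        · refine Or.inr ?_
          rw [mem_ball_iff_norm]
          have h1 : w + t * v - (w + τ * v) = ((t - τ : ℝ) : ℂ) * v := by push_cast; ring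
          dsimp only
          rw [h1, norm_mul, Complex.norm_real, Real.norm_of_nonneg (sub_nonneg.2 h.le)]
          have h2 : t - τ ≤ δ / (2 * ‖v‖) := by linarith [ht.2]
          calc (t - τ) * ‖v‖ ≤ δ / (2 * ‖v‖) * ‖v‖ := by gcongr
            _ = δ / 2 := by field_simp
            _ < δ := half_lt_self hδ
      -- The union of `N` and the new disc need not be convex; a thin neighbourhood of the segment
      -- restores convexity.
      obtain ⟨ε, hε, hεsub⟩ := (isCompact_Icc.image hcont).exists_thickening_subset_open
        (hNo.union Metric.isOpen_ball) hsub
      have hseg : Convex ℝ ((fun t : ℝ => w + t * v) '' Icc 0 τ') := by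
        have h := ((convex_Icc 0 τ').linear_image (LinearMap.toSpanSingleton ℝ ℂ v)).translate w
        simpa [image_image] using h
      refine ⟨_, f, Metric.isOpen_thickening, hseg.thickening ε, fun t ht =>
        Metric.self_subset_thickening hε _ (mem_image_of_mem _ ht), hf.mono hεsub, ?_⟩
      rw [hfg hwτ, hgw]
  obtain ⟨n, hn⟩ := exists_nat_ge (T / (δ / (2 * ‖v‖)))
  have h := key n
  rwa [min_eq_right ((div_le_iff₀ hη).1 hn)] at h

end IsDissipative

/-! ### Forward solutions and their gluing. -/

/-- `g` is a solution on an open set `U` which is stable by moving forward in `H` along `v`, and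
whose projection along `v` is an interval. -/
structure IsForwardSolution (F : ℂ × ℂ → ℂ) (H : Set ℂ) (r : ℝ) (v : ℂ) (U : Set ℂ)
    (g : ℂ → ℂ) : Prop where
  isOpen : IsOpen U
  isSolutionOn : IsSolutionOn F (H ×ˢ Metric.ball 0 r) g U
  forward : ∀ w ∈ U, ∀ t : ℝ, 0 ≤ t → w + t * v ∈ H → w + t * v ∈ U
  ordConnected : ((fun z : ℂ => (z / v).im) '' U).OrdConnected

theorem add_mul_eq_of_div_im_eq {v : ℂ} (hv : v ≠ 0) {a b : ℂ} (h : (a / v).im = (b / v).im) :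
    b = a + ((b / v).re - (a / v).re : ℝ) * v := by
  have h1 : b / v = a / v + ((b / v).re - (a / v).re : ℝ) := by
    apply Complex.ext <;> simp [h]
  rwa [div_eq_iff hv, add_mul, div_mul_cancel₀ _ hv] at h1

namespace IsForwardSolution

variable {F : ℂ × ℂ → ℂ} {H : Set ℂ} {r : ℝ} {v : ℂ} {U V : Set ℂ} {g h : ℂ → ℂ}

theorem subset (hg : IsForwardSolution F H r v U g) : U ⊆ H :=
  fun w hw => (hg.isSolutionOn w hw).1.1

/-- Of two points on the same line directed by `v`, the one further ahead lies in both sets, by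
forward stability. -/
theorem image_inter (hv : v ≠ 0) (hg : IsForwardSolution F H r v U g)
    (hh : IsForwardSolution F H r v V h) :
    (fun z : ℂ => (z / v).im) '' (U ∩ V) =
      (fun z : ℂ => (z / v).im) '' U ∩ (fun z : ℂ => (z / v).im) '' V := by
  refine Subset.antisymm (image_inter_subset _ _ _) ?_
  rintro _ ⟨⟨a, ha, rfl⟩, b, hb, hab⟩
  dsimp only at hab
  rcases le_total (a / v).re (b / v).re with hle | hle
  · refine ⟨b, ⟨?_, hb⟩, hab⟩
    have he := add_mul_eq_of_div_im_eq hv hab.symm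
    have hbH := hh.subset hb
    rw [he] at hbH ⊢
    exact hg.forward a ha _ (sub_nonneg.2 hle) hbH
  · refine ⟨a, ⟨ha, ?_⟩, rfl⟩
    have he := add_mul_eq_of_div_im_eq hv hab
    have haH := hg.subset ha
    rw [he] at haH ⊢
    exact hh.forward b hb _ (sub_nonneg.2 hle) haH

/-- The intersection inherits interval fibres and an interval projection. This connectedness is what
excludes monodromy. -/
theorem isPreconnected_inter (hF : IsDissipative F H r v) (hg : IsForwardSolution F H r v U g)
    (hh : IsForwardSolution F H r v V h) : IsPreconnected (U ∩ V) := by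
  rcases (U ∩ V).eq_empty_or_nonempty with he | hne
  · rw [he]
    exact isPreconnected_empty
  have hc : ContractibleSpace (U ∩ V : Set ℂ) := by
    refine contractibleSpace_of_convex_fibers hF.ne_zero (hg.isOpen.inter hh.isOpen) hne ?_ ?_
    · rw [hg.image_inter hF.ne_zero hh]
      exact hg.ordConnected.inter hh.ordConnected
    · intro z hz T hT s hs
      have hH := hF.convex.add_mul_mem (hg.subset hz.1) (hg.subset hT.1) hs
      exact ⟨hg.forward z hz.1 s hs.1 hH, hh.forward z hz.2 s hs.1 hH⟩
  exact isPreconnected_iff_preconnectedSpace.2 inferInstance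

theorem exists_glue (hF : IsDissipative F H r v) (hg : IsForwardSolution F H r v U g)
    (hh : IsForwardSolution F H r v V h) {w : ℂ} (hwU : w ∈ U) (hwV : w ∈ V) (heq : g w = h w) :
    ∃ f, IsForwardSolution F H r v (U ∪ V) f ∧ EqOn f g U ∧ EqOn f h V := by
  obtain ⟨f, hf, hfg, hfh⟩ := hg.isSolutionOn.exists_glue hg.isOpen hh.isOpen hh.isSolutionOn
    (IsSolutionOn.eqOn_of_isPreconnected hF.analyticOnNhd (hg.isOpen.inter hh.isOpen)
      (hg.isPreconnected_inter hF hh) (hg.isSolutionOn.mono inter_subset_left)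
      (hh.isSolutionOn.mono inter_subset_right) ⟨hwU, hwV⟩ heq)
  refine ⟨f, ⟨hg.isOpen.union hh.isOpen, hf, ?_, ?_⟩, hfg, hfh⟩
  · rintro z (hz | hz) t ht hH
    · exact Or.inl (hg.forward z hz t ht hH)
    · exact Or.inr (hh.forward z hz t ht hH)
  · rw [image_union]
    have h1 : (w / v).im ∈ (fun z : ℂ => (z / v).im) '' U := ⟨w, hwU, rfl⟩
    have h2 : (w / v).im ∈ (fun z : ℂ => (z / v).im) '' V := ⟨w, hwV, rfl⟩
    exact (IsPreconnected.union _ h1 h2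
      hg.ordConnected.isPreconnected hh.ordConnected.isPreconnected).ordConnected

end IsForwardSolution

/-- The domain is the part of `H` swept by a small disc `D` moving along `v`. The value at `x` is
obtained by continuing the local solution along a segment from `D` to `x`. -/
theorem IsDissipative.exists_isForwardSolution {F : ℂ × ℂ → ℂ} {H : Set ℂ} {r : ℝ} {v : ℂ}
    (hF : IsDissipative F H r v) {p : ℂ × ℂ} (hp : p ∈ H ×ˢ Metric.ball (0 : ℂ) r) :
    ∃ U g, IsForwardSolution F H r v U g ∧ p.1 ∈ U ∧ g p.1 = p.2 := by
  obtain ⟨δ, hδ, hex⟩ := exists_isSolutionOn_of_isCompact hF.analyticOnNhd hF.isOpen_prod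
    isCompact_singleton (singleton_subset_iff.2 hp)
  obtain ⟨g, hg, hgp⟩ := hex p rfl
  set D := Metric.ball p.1 δ
  have hDo : IsOpen D := Metric.isOpen_ball
  have hDc : Convex ℝ D := convex_ball _ _
  have hpD : p.1 ∈ D := Metric.mem_ball_self hδ
  set U : Set ℂ := {x | x ∈ H ∧ ∃ t : ℝ, 0 ≤ t ∧ x - t * v ∈ D}
  -- The starting point `x - t * v` depends arbitrarily on `x`; outside `U` the data are
  -- placeholders.
  have hstrip : ∀ x, ∃ (t : ℝ) (N : Set ℂ) (k : ℂ → ℂ), x ∈ U → 0 ≤ t ∧ x - t * v ∈ D ∧ IsOpen N ∧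
      Convex ℝ N ∧ (∀ s ∈ Icc 0 t, x - t * v + (s : ℝ) * v ∈ N) ∧
      IsSolutionOn F (H ×ˢ Metric.ball 0 r) k N ∧ k (x - t * v) = g (x - t * v) := by
    intro x
    by_cases hx : x ∈ U
    · obtain ⟨hxH, t, ht, hxD⟩ := hx
      have h1 := (hg _ hxD).1
      obtain ⟨N, k, hN⟩ := hF.exists_isSolutionOn_segment h1.1 h1.2 ht (by simpa using hxH)
      exact ⟨t, N, k, fun _ => ⟨ht, hxD, hN⟩⟩
    · exact ⟨0, ∅, 0, fun h => absurd h hx⟩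
  choose t N k ht hD hNo hNc hN hk hkg using hstrip
  have hxN : ∀ x (hx : x ∈ U), x ∈ N x := fun x hx => by
    simpa using hN x hx (t x) (right_mem_Icc.2 (ht x hx))
  have hagree : ∀ x (hx : x ∈ U), EqOn (k x) g (N x ∩ D) := fun x hx =>
    IsSolutionOn.eqOn_of_isPreconnected hF.analyticOnNhd ((hNo x hx).inter hDo)
      ((hNc x hx).inter hDc).isPreconnected ((hk x hx).mono inter_subset_left)
      (hg.mono inter_subset_right)
      ⟨by simpa using hN x hx 0 (left_mem_Icc.2 (ht x hx)), hD x hx⟩ (hkg x hx)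
  have hUo : IsOpen U := by
    refine isOpen_iff_mem_nhds.2 fun x hx => ?_
    obtain ⟨hxH, s, hs, hxD⟩ := hx
    have hc : ContinuousAt (fun x : ℂ => x - s * v) x := by fun_prop
    filter_upwards [hF.isOpen.mem_nhds hxH, hc.eventually_mem (hDo.mem_nhds hxD)] with z h1 h2
      using ⟨h1, s, hs, h2⟩
  have hpU : p.1 ∈ U := ⟨hp.1, 0, le_rfl, by simpa using hpD⟩
  refine ⟨U, fun x => k x x, ⟨hUo, ?_, ?_, ?_⟩, hpU, ?_⟩
  · refine IsSolutionOn.of_eventuallyEq fun x₀ hx₀ => ⟨k x₀, N x₀, hk x₀ hx₀, hxN x₀ hx₀, ?_⟩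
    have hc : ContinuousAt (fun x : ℂ => x - t x₀ * v) x₀ := by fun_prop
    have h0N : x₀ - t x₀ * v ∈ N x₀ := by simpa using hN x₀ hx₀ 0 (left_mem_Icc.2 (ht x₀ hx₀))
    filter_upwards [hUo.mem_nhds hx₀, (hNo x₀ hx₀).mem_nhds (hxN x₀ hx₀),
      hc.eventually_mem ((hNo x₀ hx₀).mem_nhds h0N), hc.eventually_mem (hDo.mem_nhds (hD x₀ hx₀))]
      with x hx h1 h2 h3
    -- Of the two starting times, the smaller gives a point of `D` common to both strips. Both
    -- continuations equal `g` there, hence agree on the connected overlap.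
    have hq : ∃ q, q ∈ D ∧ q ∈ N x ∧ q ∈ N x₀ := by
      rcases le_total (t x) (t x₀) with hle | hle
      · refine ⟨x - t x * v, hD x hx, by simpa using hN x hx 0 (left_mem_Icc.2 (ht x hx)), ?_⟩
        have h := (hNc x₀ hx₀).add_mul_mem h2 (v := v) (T := t x₀) (s := t x₀ - t x)
          (by simpa using h1) ⟨sub_nonneg.2 hle, sub_le_self _ (ht x hx)⟩
        convert h using 1
        push_cast
        ring
      · refine ⟨x - t x₀ * v, h3, ?_, h2⟩
        have h := hN x hx (t x - t x₀) ⟨sub_nonneg.2 hle, sub_le_self _ (ht x₀ hx₀)⟩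
        convert h using 1
        push_cast
        ring
    obtain ⟨q, hqD, hqx, hqx₀⟩ := hq
    exact IsSolutionOn.eqOn_of_isPreconnected hF.analyticOnNhd ((hNo x hx).inter (hNo x₀ hx₀))
      ((hNc x hx).inter (hNc x₀ hx₀)).isPreconnected ((hk x hx).mono inter_subset_left)
      ((hk x₀ hx₀).mono inter_subset_right) ⟨hqx, hqx₀⟩
      ((hagree x hx ⟨hqx, hqD⟩).trans (hagree x₀ hx₀ ⟨hqx₀, hqD⟩).symm) ⟨hxN x hx, h1⟩
  · rintro w ⟨-, s, hs, hwD⟩ s' hs' hH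
    refine ⟨hH, s + s', by positivity, ?_⟩
    convert hwD using 1
    push_cast
    ring
  · have himage : (fun z : ℂ => (z / v).im) '' U = (fun z : ℂ => (z / v).im) '' D := by
      refine Subset.antisymm ?_ (image_mono fun x hx => ⟨(hg x hx).1.1, 0, le_rfl, by simpa using hx⟩)
      rintro _ ⟨x, ⟨-, s, -, hs⟩, rfl⟩
      refine ⟨_, hs, ?_⟩
      simp [sub_div, hF.ne_zero]
    rw [himage]
    exact (hDc.isPreconnected.image _ (by fun_prop)).ordConnected
  · exact (hagree _ hpU ⟨hxN _ hpU, hpD⟩).trans hgp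
-- The leaf topology.
namespace FoliatedSpace

variable {ω : OneForm} {W : Set (ℂ × ℂ)}

/-- The inclusion of a foliated set into `ℂ²`. -/
def val (p : FoliatedSpace ω W) : ℂ × ℂ := Subtype.val (p := (· ∈ W)) p

/-- A point of a foliated set, seen in the leaf topology. -/
def mk (p : ℂ × ℂ) (hp : p ∈ W) : FoliatedSpace ω W := Subtype.mk p hp

theorem val_mem (p : FoliatedSpace ω W) : p.val ∈ W := Subtype.property (p := (· ∈ W)) p

@[simp] theorem val_mk (p : ℂ × ℂ) (hp : p ∈ W) : (mk p hp : FoliatedSpace ω W).val = p := rfl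

theorem val_injective : Function.Injective (val : FoliatedSpace ω W → ℂ × ℂ) :=
  Subtype.val_injective

theorem isOpen_iff {O : Set (FoliatedSpace ω W)} :
    IsOpen O ↔ ∀ φ : TangentDisc ω W, IsOpen (φ.toFoliatedSpace ⁻¹' O) := by
  rw [isOpen_iSup_iff]
  exact forall_congr' fun φ => isOpen_coinduced

theorem continuous_val : Continuous (val : FoliatedSpace ω W → ℂ × ℂ) :=
  continuous_iSup_dom.2 fun φ => continuous_coinduced_dom.2
    (continuousOn_iff_continuous_domRestrict.1 φ.holomorphic.continuousOn)

end FoliatedSpace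

/-! ### Leaves as graphs over contractible projections. -/

/-- Two points of `H × r𝔻` lie on the graph of a common forward solution. -/
def OnCommonSolution (F : ℂ × ℂ → ℂ) (H : Set ℂ) (r : ℝ) (v : ℂ) (p q : ℂ × ℂ) : Prop :=
  ∃ U g, IsForwardSolution F H r v U g ∧ p.1 ∈ U ∧ g p.1 = p.2 ∧ q.1 ∈ U ∧ g q.1 = q.2

section Leaves

variable {F : ℂ × ℂ → ℂ} {H : Set ℂ} {r : ℝ} {v : ℂ} {p q s : ℂ × ℂ}

theorem OnCommonSolution.symm (h : OnCommonSolution F H r v p q) :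
    OnCommonSolution F H r v q p := by
  obtain ⟨U, g, hg, hp, hgp, hq, hgq⟩ := h
  exact ⟨U, g, hg, hq, hgq, hp, hgp⟩

theorem OnCommonSolution.trans (hF : IsDissipative F H r v) (h : OnCommonSolution F H r v p q)
    (h' : OnCommonSolution F H r v q s) : OnCommonSolution F H r v p s := by
  obtain ⟨U, g, hg, hp, hgp, hq, hgq⟩ := h
  obtain ⟨V, k, hk, hq', hkq, hs, hks⟩ := h'
  obtain ⟨f, hf, hfg, hfk⟩ := hg.exists_glue hF hk hq hq' (hgq.trans hkq.symm)
  exact ⟨U ∪ V, f, hf, Or.inl hp, (hfg hp).trans hgp, Or.inr hs, (hfk hs).trans hks⟩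

theorem OnCommonSolution.mem_right (h : OnCommonSolution F H r v p q) :
    q ∈ H ×ˢ Metric.ball (0 : ℂ) r := by
  obtain ⟨U, g, hg, -, -, hq, hgq⟩ := h
  have h := (hg.isSolutionOn _ hq).1
  rwa [hgq] at h

theorem IsDissipative.onCommonSolution_refl (hF : IsDissipative F H r v)
    (hp : p ∈ H ×ˢ Metric.ball (0 : ℂ) r) : OnCommonSolution F H r v p p := by
  obtain ⟨U, g, hg, hp, hgp⟩ := hF.exists_isForwardSolution hp
  exact ⟨U, g, hg, hp, hgp, hp, hgp⟩

/-- This makes a class a graph: gluing puts `q` and `s` on one single-valued solution. -/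
theorem OnCommonSolution.eq_of_fst_eq (hF : IsDissipative F H r v)
    (h : OnCommonSolution F H r v p q) (h' : OnCommonSolution F H r v p s) (hqs : q.1 = s.1) :
    q = s := by
  obtain ⟨U, g, hg, hq, hgq, hs, hgs⟩ := h.symm.trans hF h'
  exact Prod.ext hqs (by rw [← hgq, ← hgs, hqs])

/-- The projection of a leaf to the plane of the variable `z`. -/
def leafProjection (F : ℂ × ℂ → ℂ) (H : Set ℂ) (r : ℝ) (v : ℂ) (p : ℂ × ℂ) : Set ℂ :=
  {z | ∃ y, OnCommonSolution F H r v p (z, y)}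

theorem exists_isForwardSolution_of_mem_leafProjection {z : ℂ}
    (hz : z ∈ leafProjection F H r v p) :
    ∃ U g, IsForwardSolution F H r v U g ∧ p.1 ∈ U ∧ g p.1 = p.2 ∧ z ∈ U ∧
      ∀ w ∈ U, OnCommonSolution F H r v p (w, g w) := by
  obtain ⟨y, U, g, hg, hp, hgp, hz, hgz⟩ := hz
  exact ⟨U, g, hg, hp, hgp, hz, fun w hw => ⟨U, g, hg, hp, hgp, hw, rfl⟩⟩

theorem isOpen_leafProjection : IsOpen (leafProjection F H r v p) := by
  refine isOpen_iff_mem_nhds.2 fun z hz => ?_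
  obtain ⟨U, g, hg, -, -, hzU, hU⟩ := exists_isForwardSolution_of_mem_leafProjection hz
  filter_upwards [hg.isOpen.mem_nhds hzU] with w hw using ⟨g w, hU w hw⟩

/-- Any two points of a class lie on one forward solution, which gives the interval projection;
forward stability and convexity of `H` give the interval fibres. -/
theorem contractibleSpace_leafProjection (hF : IsDissipative F H r v)
    (hp : p ∈ H ×ˢ Metric.ball (0 : ℂ) r) : ContractibleSpace (leafProjection F H r v p) := by
  refine contractibleSpace_of_convex_fibers hF.ne_zero isOpen_leafProjection
    ⟨p.1, p.2, hF.onCommonSolution_refl hp⟩ ⟨?_⟩ ?_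
  · rintro _ ⟨a, ⟨b, hab⟩, rfl⟩ _ ⟨c, ⟨d, hcd⟩, rfl⟩
    obtain ⟨U, g, hg, ha, hga, hc, hgc⟩ := hab.symm.trans hF hcd
    refine (hg.ordConnected.out ⟨a, ha, rfl⟩ ⟨c, hc, rfl⟩).trans (image_mono fun w hw => ?_)
    exact ⟨g w, hab.trans hF ⟨U, g, hg, ha, hga, hw, rfl⟩⟩
  · rintro z ⟨y, hzy⟩ T ⟨y', hTy'⟩ s hs
    obtain ⟨U, g, hg, -, -, hz, hU⟩ := exists_isForwardSolution_of_mem_leafProjection ⟨y, hzy⟩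
    exact ⟨_, hU _ (hg.forward z hz s hs.1
      (hF.convex.add_mul_mem hzy.mem_right.1 hTy'.mem_right.1 hs))⟩

variable {ω : OneForm}

theorem TangentDisc.eventually_onCommonSolution (hF : IsDissipative F H r v)
    (hω : ∀ p ∈ H ×ˢ Metric.ball (0 : ℂ) r, ∀ u, ω p u = 0 ↔ u.2 = F p * u.1)
    (φ : TangentDisc ω (H ×ˢ Metric.ball 0 r)) {t₀ : ℂ} (ht₀ : t₀ ∈ Metric.ball (0 : ℂ) 1) :
    ∀ᶠ t in 𝓝 t₀, OnCommonSolution F H r v (φ.toFun t₀) (φ.toFun t) := by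
  obtain ⟨U, g, hg, hpU, hgp⟩ := hF.exists_isForwardSolution (φ.mapsTo ht₀)
  have hd : ∀ᶠ t in 𝓝 t₀, t ∈ Metric.ball (0 : ℂ) 1 ∧ DifferentiableAt ℂ φ.toFun t := by
    filter_upwards [Metric.isOpen_ball.mem_nhds ht₀] with t ht
      using ⟨ht, φ.holomorphic.differentiableAt (Metric.isOpen_ball.mem_nhds ht)⟩
  have hcurve := hg.isSolutionOn.eventually_curve_eq hF.analyticOnNhd hg.isOpen
    (a := fun t => (φ.toFun t).1) (b := fun t => (φ.toFun t).2) (t₀ := t₀)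
    (hd.mono fun t ht => ht.2.fst) (hd.mono fun t ht => by
      have h1 : HasDerivAt (fun t => (φ.toFun t).1) (deriv φ.toFun t).1 t := by
        simpa using ht.2.hasDerivAt.hasFDerivAt.fst.hasDerivAt
      have h2 : HasDerivAt (fun t => (φ.toFun t).2) (deriv φ.toFun t).2 t := by
        simpa using ht.2.hasDerivAt.hasFDerivAt.snd.hasDerivAt
      have h3 := (hω _ (φ.mapsTo ht.1) _).1 (φ.tangent t ht.1)
      rwa [h1.deriv, ← h3]) hpU hgp.symm
  have hcont : ContinuousAt (fun t => (φ.toFun t).1) t₀ := hd.self_of_nhds.2.fst.continuousAt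
  filter_upwards [hcurve, hcont.eventually_mem (hg.isOpen.mem_nhds hpU)] with t h1 h2
    using ⟨U, g, hg, hpU, hgp, h2, h1.symm⟩

/-- Tangent discs stay locally in one class, so classes are open; they partition the space, so they
are also closed. -/
theorem isClopen_setOf_onCommonSolution (hF : IsDissipative F H r v)
    (hω : ∀ p ∈ H ×ˢ Metric.ball (0 : ℂ) r, ∀ u, ω p u = 0 ↔ u.2 = F p * u.1) (p : ℂ × ℂ) :
    IsClopen {q : FoliatedSpace ω (H ×ˢ Metric.ball (0 : ℂ) r) |
      OnCommonSolution F H r v p q.val} := by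
  have key : ∀ (φ : TangentDisc ω (H ×ˢ Metric.ball 0 r)) (t₀ : Metric.ball (0 : ℂ) 1),
      ∀ᶠ t : Metric.ball (0 : ℂ) 1 in 𝓝 t₀,
        OnCommonSolution F H r v (φ.toFun t₀) (φ.toFun t) := fun φ t₀ =>
    continuous_subtype_val.continuousAt.eventually (φ.eventually_onCommonSolution hF hω t₀.2)
  constructor
  · rw [← isOpen_compl_iff, FoliatedSpace.isOpen_iff]
    refine fun φ => isOpen_iff_mem_nhds.2 fun t₀ ht₀ => ?_
    filter_upwards [key φ t₀] with t ht h using ht₀ (OnCommonSolution.trans hF h ht.symm)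
  · rw [FoliatedSpace.isOpen_iff]
    refine fun φ => isOpen_iff_mem_nhds.2 fun t₀ ht₀ => ?_
    filter_upwards [key φ t₀] with t ht using OnCommonSolution.trans hF ht₀ ht

/-- Graphs of solutions are open for the leaf topology. -/
theorem IsSolutionOn.eventually_mem_of_isOpen {W : Set (ℂ × ℂ)}
    (hω : ∀ p ∈ W, ∀ u, ω p u = 0 ↔ u.2 = F p * u.1) {g : ℂ → ℂ} {U : Set ℂ} (hU : IsOpen U)
    (hg : IsSolutionOn F W g U) {O : Set (FoliatedSpace ω W)} (hO : IsOpen O) {x : ℂ} (hx : x ∈ U)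
    (hxO : FoliatedSpace.mk (x, g x) (hg x hx).1 ∈ O) :
    ∀ᶠ w in 𝓝 x, ∃ hw : (w, g w) ∈ W, FoliatedSpace.mk (w, g w) hw ∈ O := by
  obtain ⟨ε, hε, hball⟩ := Metric.isOpen_iff.1 hU x hx
  have hεC : (ε : ℂ) ≠ 0 := by exact_mod_cast hε.ne'
  have hmaps : ∀ t ∈ Metric.ball (0 : ℂ) 1, x + ε * t ∈ U := by
    intro t ht
    refine hball ?_
    rw [mem_ball_zero_iff] at ht
    rw [mem_ball_iff_norm, add_sub_cancel_left, norm_mul, Complex.norm_real,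
      Real.norm_of_nonneg hε.le]
    exact mul_lt_of_lt_one_right hε ht
  have hderiv : ∀ t ∈ Metric.ball (0 : ℂ) 1, HasDerivAt (fun t => (x + ε * t, g (x + ε * t)))
      ((ε : ℂ), F (x + ε * t, g (x + ε * t)) * ε) t := by
    intro t ht
    have h1 : HasDerivAt (fun t : ℂ => x + ε * t) ε t := by
      simpa using ((hasDerivAt_id t).const_mul (ε : ℂ)).const_add x
    exact h1.prodMk (HasDerivAt.comp t (hg _ (hmaps t ht)).2 h1)
  -- The graph of `g` over a disc around `x`, rescaled to the unit disc, is a test disc for the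
  -- openness of `O`.
  let φ : TangentDisc ω W :=
    { toFun := fun t => (x + ε * t, g (x + ε * t))
      holomorphic := fun t ht => (hderiv t ht).differentiableAt.differentiableWithinAt
      mapsTo := fun t ht => (hg _ (hmaps t ht)).1
      tangent := fun t ht => by
        rw [(hderiv t ht).deriv, hω _ (hg _ (hmaps t ht)).1] }
  have hopen := FoliatedSpace.isOpen_iff.1 hO φ
  obtain ⟨O', hO', hOeq⟩ := isOpen_induced_iff.1 hopen
  have h0 : (0 : ℂ) ∈ O' := by
    have h : (⟨0, Metric.mem_ball_self one_pos⟩ : Metric.ball (0 : ℂ) 1) ∈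
        φ.toFoliatedSpace ⁻¹' O := by
      refine mem_preimage.2 ?_
      convert hxO using 1
      refine FoliatedSpace.val_injective ?_
      change (x + ε * 0, g (x + ε * 0)) = (x, g x)
      simp
    rw [← hOeq] at h
    exact h
  have hc : ContinuousAt (fun w : ℂ => (w - x) / ε) x := by fun_prop
  have h1 : ∀ᶠ w in 𝓝 x, (w - x) / ε ∈ O' ∩ Metric.ball (0 : ℂ) 1 :=
    hc.eventually_mem ((hO'.inter Metric.isOpen_ball).mem_nhds (by simp [h0]))
  filter_upwards [h1] with w hw
  have h2 : (⟨(w - x) / ε, hw.2⟩ : Metric.ball (0 : ℂ) 1) ∈ φ.toFoliatedSpace ⁻¹' O := by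
    rw [← hOeq]
    exact hw.1
  have h3 : x + ε * ((w - x) / ε) = w := by field_simp; ring
  have h4 : φ.toFun ((w - x) / ε) = (w, g w) := by
    change (x + ε * ((w - x) / ε), g (x + ε * ((w - x) / ε))) = (w, g w)
    rw [h3]
  have hwW : (w, g w) ∈ W := h4 ▸ φ.mapsTo hw.2
  refine ⟨hwW, ?_⟩
  convert mem_preimage.1 h2 using 1
  exact FoliatedSpace.val_injective h4.symm

/-- A class of points on common solutions is homeomorphic to its projection. -/
noncomputable def leafHomeomorph (hF : IsDissipative F H r v)
    (hω : ∀ p ∈ H ×ˢ Metric.ball (0 : ℂ) r, ∀ u, ω p u = 0 ↔ u.2 = F p * u.1) (p : ℂ × ℂ) :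
    {q : FoliatedSpace ω (H ×ˢ Metric.ball (0 : ℂ) r) | OnCommonSolution F H r v p q.val} ≃ₜ
      leafProjection F H r v p where
  toFun q := ⟨q.1.val.1, q.1.val.2, q.2⟩
  invFun z := ⟨FoliatedSpace.mk (z.1, z.2.choose) z.2.choose_spec.mem_right, z.2.choose_spec⟩
  left_inv q := Subtype.ext <| FoliatedSpace.val_injective <|
    OnCommonSolution.eq_of_fst_eq hF (Exists.choose_spec (⟨q.1.val.2, q.2⟩ :
      ∃ y, OnCommonSolution F H r v p (q.1.val.1, y))) q.2 rfl
  right_inv z := rfl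
  continuous_toFun :=
    (continuous_fst.comp (FoliatedSpace.continuous_val.comp continuous_subtype_val)).subtype_mk _
  continuous_invFun := by
    refine Continuous.subtype_mk ?_ _
    refine continuous_def.2 fun O hO => isOpen_iff_mem_nhds.2 fun z hz => ?_
    obtain ⟨U, g, hg, -, -, hzU, hU⟩ := exists_isForwardSolution_of_mem_leafProjection z.2
    -- The chosen ordinate is unique, so it coincides near `z` with the holomorphic solution `g`.
    have heq : ∀ w : leafProjection F H r v p, w.1 ∈ U → (w.1, w.2.choose) = (w.1, g w.1) :=
      fun w hw => OnCommonSolution.eq_of_fst_eq hF w.2.choose_spec (hU _ hw) rfl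
    have hzO : FoliatedSpace.mk (z.1, g z.1) (hg.isSolutionOn _ hzU).1 ∈ O := by
      convert mem_preimage.1 hz using 1
      exact FoliatedSpace.val_injective (heq z hzU).symm
    have h := hg.isSolutionOn.eventually_mem_of_isOpen hω hg.isOpen hO hzU hzO
    filter_upwards [continuous_subtype_val.continuousAt.eventually h,
      continuous_subtype_val.continuousAt.eventually_mem (hg.isOpen.mem_nhds hzU)] with w hw hwU
    obtain ⟨hwW, hwO⟩ := hw
    refine mem_preimage.2 ?_
    convert hwO using 1
    exact FoliatedSpace.val_injective (heq w hwU)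

/-- The leaves of a dissipative equation are simply connected. -/
theorem IsDissipative.simplyConnectedSpace_leaf (hF : IsDissipative F H r v)
    (hω : ∀ p ∈ H ×ˢ Metric.ball (0 : ℂ) r, ∀ u, ω p u = 0 ↔ u.2 = F p * u.1)
    {L : Set (FoliatedSpace ω (H ×ˢ Metric.ball (0 : ℂ) r))} (hL : IsLeaf L) :
    SimplyConnectedSpace L := by
  obtain ⟨p, rfl⟩ := hL
  have hc := contractibleSpace_leafProjection hF p.val_mem
  have hc' := (leafHomeomorph hF hω p.val).contractibleSpace
  have hp : p ∈ {q : FoliatedSpace ω (H ×ˢ Metric.ball (0 : ℂ) r) |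
      OnCommonSolution F H r v p.val q.val} := hF.onCommonSolution_refl p.val_mem
  -- The class is clopen and, being homeomorphic to a contractible set, connected; hence it is the
  -- whole leaf.
  have hcomp : connectedComponent p = {q : FoliatedSpace ω (H ×ˢ Metric.ball (0 : ℂ) r) |
      OnCommonSolution F H r v p.val q.val} :=
    Subset.antisymm ((isClopen_setOf_onCommonSolution hF hω p.val).connectedComponent_subset hp)
      ((isPreconnected_iff_preconnectedSpace.2 inferInstance).subset_connectedComponent hp)
  rw [hcomp]
  infer_instance

end Leaves

/-! ### Application to the pulled-back form. -/

theorem coverDomain_eq_prod (ρ r : ℝ) :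
    coverDomain ρ r = {z : ℂ | ‖Complex.exp z‖ < ρ} ×ˢ Metric.ball (0 : ℂ) r := by
  ext ⟨z, y⟩
  simp [coverDomain, expCover, polydisc]

/-- The direction `-lam` cancels the denominator of `F`: the quantity to be signed becomes `-|y|² Re
(1 + R)`. -/
theorem isDissipative_of_norm_lt_one {lam : ℂ} (hlam : lam ≠ 0) {R : ℂ × ℂ → ℂ} {ρ r : ℝ}
    (hρ : 0 < ρ) (hR : AnalyticOnNhd ℂ R (polydisc ρ r)) (hR1 : ∀ p ∈ polydisc ρ r, ‖R p‖ < 1) :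
    IsDissipative (fun p => p.2 * (1 + R (Complex.exp p.1, p.2)) / lam)
      {z : ℂ | ‖Complex.exp z‖ < ρ} r (-lam) where
  isOpen := isOpen_lt (by fun_prop) continuous_const
  convex := by
    have h : {z : ℂ | ‖Complex.exp z‖ < ρ} = {z : ℂ | z.re < Real.log ρ} := by
      ext z
      change ‖Complex.exp z‖ < ρ ↔ z.re < Real.log ρ
      rw [Complex.norm_exp, Real.lt_log_iff_exp_lt hρ]
    rw [h]
    exact convex_halfSpace_re_lt _
  ne_zero := neg_ne_zero.2 hlam
  analyticOnNhd := by
    rintro p ⟨hp1, hp2⟩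
    have hmem : (Complex.exp p.1, p.2) ∈ polydisc ρ r := ⟨mem_ball_zero_iff.2 hp1, hp2⟩
    have h1 : AnalyticAt ℂ (fun p : ℂ × ℂ => (Complex.exp p.1, p.2)) p :=
      analyticAt_fst.cexp.prod analyticAt_snd
    have h2 : AnalyticAt ℂ (fun p : ℂ × ℂ => R (Complex.exp p.1, p.2)) p :=
      AnalyticAt.fun_comp (hR _ hmem) h1
    exact (analyticAt_snd.mul (analyticAt_const.add h2)).div analyticAt_const hlam
  re_le := by
    rintro p ⟨hp1, hp2⟩
    have hmem : (Complex.exp p.1, p.2) ∈ polydisc ρ r := ⟨mem_ball_zero_iff.2 hp1, hp2⟩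
    have h1 := hR1 _ hmem
    have h2 : -1 < (R (Complex.exp p.1, p.2)).re :=
      neg_lt_of_abs_lt ((Complex.abs_re_le_norm _).trans_lt h1)
    have h3 : -lam * (p.2 * (1 + R (Complex.exp p.1, p.2)) / lam) * (starRingEnd ℂ) p.2 =
        ((-Complex.normSq p.2 : ℝ) : ℂ) * (1 + R (Complex.exp p.1, p.2)) := by
      push_cast
      rw [Complex.normSq_eq_conj_mul_self]
      field_simp
    rw [h3, Complex.re_ofReal_mul, Complex.add_re, Complex.one_re]
    exact mul_nonpos_of_nonpos_of_nonneg (neg_nonpos.2 (Complex.normSq_nonneg _)) (by linarith)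

theorem liftedLeavesSimplyConnected_of_norm_lt_one {lam : ℂ} (hlam : lam ≠ 0) {R : ℂ × ℂ → ℂ}
    {ρ r : ℝ} (hρ : 0 < ρ) (hR : AnalyticOnNhd ℂ R (polydisc ρ r))
    (hR1 : ∀ p ∈ polydisc ρ r, ‖R p‖ < 1) : LiftedLeavesSimplyConnected lam R ρ r := by
  unfold LiftedLeavesSimplyConnected
  rw [coverDomain_eq_prod]
  intro L hL
  refine (isDissipative_of_norm_lt_one hlam hρ hR hR1).simplyConnectedSpace_leaf
    (fun p _ u => ?_) hL
  rw [pullback_omegaForm_apply, mul_eq_zero_iff_left (Complex.exp_ne_zero _), sub_eq_zero,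
    div_mul_eq_mul_div, eq_div_iff hlam, mul_comm lam]

theorem polydisc_mono {ρ ρ' r r' : ℝ} (hρ : ρ ≤ ρ') (hr : r ≤ r') :
    polydisc ρ r ⊆ polydisc ρ' r' :=
  prod_mono (Metric.ball_subset_ball hρ) (Metric.ball_subset_ball hr)

theorem GermMemXPow.analyticAt {k : ℕ} {R : ℂ × ℂ → ℂ} (hR : GermMemXPow k R) :
    AnalyticAt ℂ R 0 := by
  obtain ⟨A, hA, hRA⟩ := hR
  exact ((analyticAt_fst.pow k).mul hA).congr (hRA.mono fun p hp => hp.symm)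

theorem GermMemXPow.apply_zero {k : ℕ} (hk : 1 ≤ k) {R : ℂ × ℂ → ℂ} (hR : GermMemXPow k R) :
    R 0 = 0 := by
  obtain ⟨A, -, hRA⟩ := hR
  rw [hRA.self_of_nhds, Prod.fst_zero, zero_pow (Nat.one_le_iff_ne_zero.1 hk), zero_mul]

theorem mainTheorem6 (lam : ℂ) (hlam : IsNondegenerateReducedRatio lam)
    (k : ℕ) (hk : 1 ≤ k) (R : ℂ × ℂ → ℂ) (hR : GermMemXPow k R) :
    (∃ ρ₀ : ℝ, 0 < ρ₀ ∧ ∃ r₀ : ℝ, 0 < r₀ ∧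
      AnalyticOnNhd ℂ R (closure (polydisc ρ₀ r₀)) ∧
      ∀ ρ r : ℝ, 0 < ρ → ρ ≤ ρ₀ → 0 < r → r ≤ r₀ → LiftedLeavesSimplyConnected lam R ρ r) ∧
    (∀ ρ₀ r₀ : ℝ, 0 < ρ₀ → 0 < r₀ →
      AnalyticOnNhd ℂ R (polydisc ρ₀ r₀) →
      (⨆ p ∈ polydisc ρ₀ r₀, ‖R p‖ₑ) < 1 →
      ∀ ρ r : ℝ, 0 < ρ → ρ ≤ ρ₀ → 0 < r → r ≤ r₀ → LiftedLeavesSimplyConnected lam R ρ r) := by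
  constructor
  -- Here `1 ≤ k` enters: it forces `R 0 = 0`, so `|R| < 1` near the origin by continuity.
  · have hsmall : ∀ᶠ p in 𝓝 (0 : ℂ × ℂ), ‖R p‖ < 1 :=
      hR.analyticAt.continuousAt.norm.eventually_lt_const (by simp [hR.apply_zero hk])
    obtain ⟨ε, hε, hball⟩ := Metric.eventually_nhds_iff_ball.1
      (hR.analyticAt.eventually_analyticAt.and hsmall)
    have hsub : closure (polydisc (ε / 2) (ε / 2)) ⊆ Metric.ball (0 : ℂ × ℂ) ε := by
      rw [polydisc, ball_prod_same]
      exact Metric.closure_ball_subset_closedBall.trans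
        (Metric.closedBall_subset_ball (half_lt_self hε))
    refine ⟨ε / 2, half_pos hε, ε / 2, half_pos hε, fun p hp => (hball p (hsub hp)).1, ?_⟩
    intro ρ r hρ hρ' _ hr'
    have hsub' : polydisc ρ r ⊆ Metric.ball (0 : ℂ × ℂ) ε :=
      (polydisc_mono hρ' hr').trans (subset_closure.trans hsub)
    exact liftedLeavesSimplyConnected_of_norm_lt_one hlam.1 hρ
      (fun p hp => (hball p (hsub' hp)).1) fun p hp => (hball p (hsub' hp)).2
  · intro ρ₀ r₀ _ _ hRa hsup ρ r hρ hρ' _ hr'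
    have hsub := polydisc_mono hρ' hr'
    refine liftedLeavesSimplyConnected_of_norm_lt_one hlam.1 hρ (hRa.mono hsub) fun p hp => ?_
    have h := (le_iSup₂ (f := fun p (_ : p ∈ polydisc ρ₀ r₀) => ‖R p‖ₑ) p (hsub hp)).trans_lt hsup
    rw [← ofReal_norm, ENNReal.ofReal_lt_one] at h
    exact h
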